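/- Let $\Xi\subset\mathbb R^p$ be a set on which derivatives are unique (for instance an open set, or a convex set with non-empty interior), and let $(f_c)_{c\in\Xi}$ be a family of probability densities on $\mathbb R^d$. Let $\mu_1,\mu_2,\dots$ be independent and identically distributed random measures on $\mathbb R^d$, defined on a common probability space $(\Omega,\mathcal F,\mathbb P)$, and let $\mathcal S_k$ be the support of $\mu_k$. Put $$W^{(k)}_c=-\log\int_{\mathcal S_k} f_c(x)\,d\mu_k(x),\qquad Z^{(k)}_c=\frac{\partial}{\partial c}W^{(k)}_c\qquad(c\in\Xi),$$ and write $W_c=W_c^{(1)}$, $Z_c=Z_c^{(1)}$. Derivatives are taken over $\Xi$; they are the ordinary ones at interior points of $\Xi$. Assume that, for every $k$, almost surely, for all $c\in\Xi$, the integral $\int_{\mathcal S_k} f_c\,d\mu_k$ is positive and finite and $c\mapsto W^{(k)}_c$ is differentiable; and that $\mathbb E\|Z_c\|<\infty$ for all $c\in\Xi$. Let $\xi\in\Xi$ be such that $\mathbb E[Z_\xi]=0$ and $\mathbb E\|Z_\xi\|^2<\infty$, and assume that the $p\times p$ matrix $$M_\xi=\frac{\partial}{\partial c^T}\mathbb E[Z_c]\Big|_{c=\xi}$$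 exists (as a total derivative) and is invertible. Let $\nu_n(c)=\sqrt n\big(\frac1n\sum_{k=1}^n Z^{(k)}_c-\mathbb E[Z_c]\big)$, $c\in\Xi$, and assume that $\nu_n$ is asymptotically continuous at $\xi$: for every sequence of $\Xi$-valued random vectors $\xi_n$ with $\xi_n\to\xi$ in probability, $\nu_n(\xi_n)-\nu_n(\xi)\to0$ in probability. Let $\tilde\xi_n$ be random vectors such that, with probability tending to one, $\tilde\xi_n\in\Xi$ and $\sum_{k=1}^n Z^{(k)}_{\tilde\xi_n}=0$, and such that $\tilde\xi_n\to\xi$ in probability. Define $$J_\xi=\mathbb E\big[Z_\xi Z_\xi^T\big],\qquad V_\xi=M_\xi^{-1}J_\xi\,[M_\xi^{-1}]^T.$$ Then $V_\xi$ is positive semidefinite and, as $n\to\infty$, $$\sqrt n(\tilde\xi_n-\xi)\stackrel{d}{\to}\mathrm N(0,V_\xi).$$ -/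

import Mathlib

open MeasureTheory ProbabilityTheory Filter Topology

noncomputable section

/-- A family `f c`, `c ∈ Ξ`, of probability densities on `ℝᵈ`. -/
structure IsParametricDensity {p d : ℕ} (Ξ : Set (EuclideanSpace ℝ (Fin p)))
    (f : EuclideanSpace ℝ (Fin p) → EuclideanSpace ℝ (Fin d) → ℝ) : Prop where
  measurable : ∀ c ∈ Ξ, Measurable (f c)
  nonneg : ∀ c ∈ Ξ, ∀ x, 0 ≤ f c x
  integral_eq_one : ∀ c ∈ Ξ, ∫ x, f c x = 1

/-- The generalized likelihood contribution `∫_S f_c dm` of one observed measure `m`,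
where `S` is the support of `m`. -/
def genLik {p d : ℕ} (f : EuclideanSpace ℝ (Fin p) → EuclideanSpace ℝ (Fin d) → ℝ)
    (m : Measure (EuclideanSpace ℝ (Fin d))) (c : EuclideanSpace ℝ (Fin p)) : ℝ :=
  ∫ x in m.support, f c x ∂m

/-- The loss `W_c = -log ∫_S f_c dm`. -/
def genLoss {p d : ℕ} (f : EuclideanSpace ℝ (Fin p) → EuclideanSpace ℝ (Fin d) → ℝ)
    (m : Measure (EuclideanSpace ℝ (Fin d))) (c : EuclideanSpace ℝ (Fin p)) : ℝ :=
  -Real.log (genLik f m c)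

/-- The score `Z_c = -d/dc log ∫_S f_c dm`, the derivative being taken over the parameter set `Ξ`
(at interior points of `Ξ` this is the ordinary gradient). -/
def genScore {p d : ℕ} (Ξ : Set (EuclideanSpace ℝ (Fin p)))
    (f : EuclideanSpace ℝ (Fin p) → EuclideanSpace ℝ (Fin d) → ℝ)
    (m : Measure (EuclideanSpace ℝ (Fin d))) (c : EuclideanSpace ℝ (Fin p)) :
    EuclideanSpace ℝ (Fin p) :=
  gradientWithin (genLoss f m) Ξ c

/-- The population score `E[Z_c]`; the first observed measure has index `0`. -/
def meanScore {Ω : Type*} [MeasurableSpace Ω] (P : Measure Ω) {p d : ℕ}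
    (Ξ : Set (EuclideanSpace ℝ (Fin p)))
    (f : EuclideanSpace ℝ (Fin p) → EuclideanSpace ℝ (Fin d) → ℝ)
    (μ : ℕ → Ω → Measure (EuclideanSpace ℝ (Fin d))) (c : EuclideanSpace ℝ (Fin p)) :
    EuclideanSpace ℝ (Fin p) :=
  ∫ ω, genScore Ξ f (μ 0 ω) c ∂P

/-- The empirical process `ν_n(c) = √n (n⁻¹ ∑_{k<n} Z_c^{(k)} - E[Z_c])`. -/
def empiricalProcess {Ω : Type*} [MeasurableSpace Ω] (P : Measure Ω) {p d : ℕ}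
    (Ξ : Set (EuclideanSpace ℝ (Fin p)))
    (f : EuclideanSpace ℝ (Fin p) → EuclideanSpace ℝ (Fin d) → ℝ)
    (μ : ℕ → Ω → Measure (EuclideanSpace ℝ (Fin d)))
    (n : ℕ) (c : EuclideanSpace ℝ (Fin p)) (ω : Ω) : EuclideanSpace ℝ (Fin p) :=
  √(n : ℝ) • ((n : ℝ)⁻¹ • (∑ k ∈ Finset.range n, genScore Ξ f (μ k ω) c) - meanScore P Ξ f μ c)

/-- Asymptotic continuity at `ξ` of a sequence of random fields indexed by `Ξ`: along every sequence
of `Ξ`-valued random vectors converging to `ξ` in probability, the increments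
`ν_n(ξ_n) - ν_n(ξ)` tend to `0` in probability. -/
def AsymptoticallyContinuousAt {Ω : Type*} [MeasurableSpace Ω] (P : Measure Ω) {p : ℕ}
    (Ξ : Set (EuclideanSpace ℝ (Fin p)))
    (ν : ℕ → EuclideanSpace ℝ (Fin p) → Ω → EuclideanSpace ℝ (Fin p))
    (ξ : EuclideanSpace ℝ (Fin p)) : Prop :=
  ∀ ξs : ℕ → Ω → EuclideanSpace ℝ (Fin p),
    (∀ n, Measurable (ξs n)) → (∀ n ω, ξs n ω ∈ Ξ) →
    (∀ ε > 0, Tendsto (fun n => P {ω | ε < ‖ξs n ω - ξ‖}) atTop (𝓝 0)) →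
    ∀ ε > 0, Tendsto (fun n => P {ω | ε < ‖ν n (ξs n ω) ω - ν n ξ ω‖}) atTop (𝓝 0)

/-- `ξt` is a Z-estimator: with probability tending to one, `ξt n` lies in `Ξ` and solves
`∑_{k<n} Z_c^{(k)} = 0`. -/
structure IsZEstimator {Ω : Type*} [MeasurableSpace Ω] (P : Measure Ω) {p d : ℕ}
    (Ξ : Set (EuclideanSpace ℝ (Fin p)))
    (f : EuclideanSpace ℝ (Fin p) → EuclideanSpace ℝ (Fin d) → ℝ)
    (μ : ℕ → Ω → Measure (EuclideanSpace ℝ (Fin d)))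
    (ξt : ℕ → Ω → EuclideanSpace ℝ (Fin p)) : Prop where
  aemeasurable : ∀ n, AEMeasurable (ξt n) P
  solves : Tendsto (fun n => P {ω | ¬ (ξt n ω ∈ Ξ ∧
    ∑ k ∈ Finset.range n, genScore Ξ f (μ k ω) (ξt n ω) = 0)}) atTop (𝓝 0)

/-- The matrix `J_ξ = E[Z_ξ Z_ξᵀ]`. -/
def scoreMatrix {Ω : Type*} [MeasurableSpace Ω] (P : Measure Ω) {p d : ℕ}
    (Ξ : Set (EuclideanSpace ℝ (Fin p)))
    (f : EuclideanSpace ℝ (Fin p) → EuclideanSpace ℝ (Fin d) → ℝ)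
    (μ : ℕ → Ω → Measure (EuclideanSpace ℝ (Fin d))) (ξ : EuclideanSpace ℝ (Fin p)) :
    Matrix (Fin p) (Fin p) ℝ :=
  Matrix.of fun i j => ∫ ω, genScore Ξ f (μ 0 ω) ξ i * genScore Ξ f (μ 0 ω) ξ j ∂P

end

/-! Where the estimator solves the score equation, `ν_n(ξt) - ν_n(ξ) = -(√n m(ξt) + N_n)`, with `m`
the mean score and `N_n` the normalized sum of the scores at `ξ`. Asymptotic continuity therefore
gives `√n m(ξt) + N_n → 0` in probability. As `m` vanishes at `ξ` with invertible derivative `M`,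
this inverts to `√n (ξt - ξ) = -M⁻¹ N_n + o_P(1)` (`tendsto_measure_smul_sub_add_symm`). No rate for
`ξt` is assumed: tightness of `N_n` provides it. The central limit theorem and Slutsky's lemma
conclude.

Two measurability issues intervene. The score is a derivative, so it is replaced a.s. by a
measurable function of the observed measure (`exists_measurable_eq_genScore`), through which
independence passes. The estimator is replaced by a measurable `Ξ`-valued one
(`exists_measurable_mem_modification`). -/

/-! ### Measurability of the score. -/

/-- The derivative within `s` of a measurable family of functions, applied to a fixed vector, is
measurable in the parameter, up to the parameters where the derivative does not exist. -/
theorem exists_measurable_eq_fderivWithin_apply {α E : Type*} [MeasurableSpace α]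
    [NormedAddCommGroup E] [NormedSpace ℝ E] [FiniteDimensional ℝ E] {s : Set E} {x : E}
    (hs : UniqueDiffWithinAt ℝ s x) (hx : x ∈ s) {W : E → α → ℝ} (hW : ∀ c ∈ s, Measurable (W c))
    (v : E) : ∃ g : α → ℝ, Measurable g ∧
      ∀ a, DifferentiableWithinAt ℝ (fun c => W c a) s x →
        fderivWithin ℝ (fun c => W c a) s x v = g a := by
  -- The span of the tangent cone is dense, and closed in finite dimension. By linearity only
  -- tangent directions matter; there the derivative is a limit along a sequence chosen
  -- independently of `a`.
  have hspan : v ∈ Submodule.span ℝ (tangentConeAt ℝ s x) := by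
    have hclosed := Submodule.closed_of_finiteDimensional (Submodule.span ℝ (tangentConeAt ℝ s x))
    have := hs.dense_tangentConeAt v
    rwa [hclosed.closure_eq] at this
  induction hspan using Submodule.span_induction with
  | zero => exact ⟨0, measurable_const, fun a _ => by simp⟩
  | add u v _ _ hu hv =>
    obtain ⟨g, hg, hgu⟩ := hu
    obtain ⟨h, hh, hhv⟩ := hv
    exact ⟨g + h, hg.add hh, fun a ha => by simp [hgu a ha, hhv a ha]⟩
  | smul r u _ hu =>
    obtain ⟨g, hg, hgu⟩ := hu
    exact ⟨r • g, hg.const_smul r, fun a ha => by simp [hgu a ha]⟩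
  | mem u hu =>
    obtain ⟨c, d, hd, hds, hcd⟩ := mem_tangentConeAt_iff_exists_seq.1 hu
    classical
    -- Measurability of `W c` is known only for `c ∈ s`. The value 0 is used for at most finitely
    -- many `n`.
    let q : ℕ → α → ℝ := fun n a => if x + d n ∈ s then c n • (W (x + d n) a - W x a) else 0
    have hq : ∀ n, Measurable (q n) := by
      intro n
      by_cases h : x + d n ∈ s
      · simpa [q, h] using ((hW _ h).sub (hW x hx)).const_mul (c n)
      · simp [q, h]
    refine ⟨fun a => limUnder atTop (q · a),
      (StronglyMeasurable.limUnder fun n => (hq n).stronglyMeasurable).measurable, fun a ha => ?_⟩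
    refine (Tendsto.limUnder_eq ?_).symm
    refine (ha.hasFDerivWithinAt.lim hd hds hcd).congr' ?_
    filter_upwards [hds] with n hn
    simp [q, hn]

theorem exists_measurable_eq_gradientWithin {α E : Type*} [MeasurableSpace α]
    [NormedAddCommGroup E] [InnerProductSpace ℝ E] [FiniteDimensional ℝ E] [MeasurableSpace E]
    [BorelSpace E] {s : Set E} {x : E}
    (hs : UniqueDiffWithinAt ℝ s x) (hx : x ∈ s) {W : E → α → ℝ}
    (hW : ∀ c ∈ s, Measurable (W c)) : ∃ G : α → E, Measurable G ∧
      ∀ a, DifferentiableWithinAt ℝ (fun c => W c a) s x →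
        gradientWithin (fun c => W c a) s x = G a := by
  choose g hg hgeq using fun v => exists_measurable_eq_fderivWithin_apply hs hx hW v
  let b := stdOrthonormalBasis ℝ E
  refine ⟨fun a => ∑ i, g (b i) a • b i,
    Finset.measurable_fun_sum _ fun i _ => (hg (b i)).smul_const (b i), fun a ha => ?_⟩
  rw [← b.sum_repr (gradientWithin (fun c => W c a) s x)]
  refine Finset.sum_congr rfl fun i _ => ?_
  rw [b.repr_apply_apply, ← hgeq (b i) a ha, real_inner_comm, gradientWithin,
    InnerProductSpace.toDual_symm_apply]

/-- The support carries the whole measure, and for a nonnegative density the Bochner integral is a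
Lebesgue integral made real, which is measurable in the measure. -/
theorem measurable_genLoss {p d : ℕ} {Ξ : Set (EuclideanSpace ℝ (Fin p))}
    {f : EuclideanSpace ℝ (Fin p) → EuclideanSpace ℝ (Fin d) → ℝ}
    (hf : IsParametricDensity Ξ f) {c : EuclideanSpace ℝ (Fin p)} (hc : c ∈ Ξ) :
    Measurable fun m => genLoss f m c := by
  have hlik : (fun m => genLik f m c) =
      fun m => (∫⁻ x, ENNReal.ofReal (f c x) ∂m).toReal := by
    ext m
    rw [genLik, Measure.restrict_eq_self_of_ae_mem (s := m.support) Measure.support_mem_ae,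
      integral_eq_lintegral_of_nonneg_ae (ae_of_all _ (hf.nonneg c hc))
        (hf.measurable c hc).aestronglyMeasurable]
  have : Measurable fun m => genLik f m c := by
    rw [hlik]
    exact (Measure.measurable_lintegral (hf.measurable c hc).ennreal_ofReal).ennreal_toReal
  exact this.log.neg

/-- The score at a fixed parameter is a measurable function of the observed measure, wherever the
loss is differentiable. -/
theorem exists_measurable_eq_genScore {p d : ℕ} {Ξ : Set (EuclideanSpace ℝ (Fin p))}
    (hΞ : UniqueDiffOn ℝ Ξ) {f : EuclideanSpace ℝ (Fin p) → EuclideanSpace ℝ (Fin d) → ℝ}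
    (hf : IsParametricDensity Ξ f) {ξ : EuclideanSpace ℝ (Fin p)} (hξ : ξ ∈ Ξ) :
    ∃ G : Measure (EuclideanSpace ℝ (Fin d)) → EuclideanSpace ℝ (Fin p), Measurable G ∧
      ∀ m, DifferentiableOn ℝ (genLoss f m) Ξ → genScore Ξ f m ξ = G m := by
  obtain ⟨G, hG, h⟩ := exists_measurable_eq_gradientWithin (hΞ ξ hξ) hξ
    (W := fun c m => genLoss f m c) fun c hc => measurable_genLoss hf hc
  exact ⟨G, hG, fun m hm => h m (hm ξ hξ)⟩

/-! ### Multivariate central limit theorem. -/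

/-- The Cramér–Wold device: it reduces vector convergence to the scalar central limit theorem for
projections. -/
theorem charFun_map_eq_charFun_map_inner {Ω E : Type*} [MeasurableSpace Ω] {P : Measure Ω}
    [NormedAddCommGroup E] [InnerProductSpace ℝ E] [MeasurableSpace E] [BorelSpace E]
    [SecondCountableTopology E] {X : Ω → E} (hX : AEMeasurable X P) (t : E) :
    charFun (P.map X) t = charFun (P.map fun ω => inner ℝ t (X ω)) 1 := by
  rw [charFun_apply, charFun_apply, integral_map hX (by fun_prop),
    integral_map (by fun_prop) (by fun_prop)]
  simp [real_inner_comm]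

/-- **Multivariate central limit theorem** for centered square integrable vectors, the covariance
matrix being given by its quadratic form. -/
theorem tendstoInDistribution_inv_sqrt_smul_sum {Ω : Type*} [MeasurableSpace Ω] {P : Measure Ω}
    [IsProbabilityMeasure P] {ι : Type*} [Fintype ι] [DecidableEq ι]
    {X : ℕ → Ω → EuclideanSpace ℝ ι} {S : Matrix ι ι ℝ} (hS : S.PosSemidef)
    (hX : MemLp (X 0) 2 P) (h0 : ∫ ω, X 0 ω ∂P = 0)
    (hcov : ∀ t : EuclideanSpace ℝ ι, ∫ ω, (inner ℝ t (X 0 ω)) ^ 2 ∂P = t ⬝ᵥ S.mulVec t)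
    (hindep : iIndepFun X P) (hident : ∀ k, IdentDistrib (X k) (X 0) P P) :
    TendstoInDistribution (fun (n : ℕ) ω => (√(n : ℝ))⁻¹ • ∑ k ∈ Finset.range n, X k ω) atTop id
      (fun _ => P) (multivariateGaussian 0 S) := by
  have hmeas : ∀ k, AEMeasurable (X k) P := fun k => (hident k).aemeasurable_fst
  have hsum : ∀ n : ℕ, AEMeasurable
      (fun ω => (√(n : ℝ))⁻¹ • ∑ k ∈ Finset.range n, X k ω) P := by fun_prop
  refine ⟨hsum, aemeasurable_id, ProbabilityMeasure.tendsto_iff_tendsto_charFun.2 fun t => ?_⟩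
  have hint : Integrable (X 0) P := hX.integrable (by norm_num)
  have hmean : ∫ ω, inner ℝ t (X 0 ω) ∂P = 0 := by rw [integral_inner hint, h0, inner_zero_right]
  have hvar : Var[fun ω => inner ℝ t (X 0 ω); P] = t ⬝ᵥ S.mulVec t := by
    rw [variance_of_integral_eq_zero (by have := hmeas 0; fun_prop) hmean]
    exact hcov t
  have hclt := tendstoInDistribution_inv_sqrt_mul_sum_sub (P := P)
    (X := fun k ω => inner ℝ t (X k ω)) (Y := id) (.id) (hX.const_inner t)
    (hindep.comp (fun _ x => inner ℝ t x) fun _ => by fun_prop)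
    (fun k => (hident k).comp (u := fun x => inner ℝ t x) (by fun_prop))
  have := ProbabilityMeasure.tendsto_iff_tendsto_charFun.1 hclt.tendsto 1
  simp only [ProbabilityMeasure.coe_mk, Measure.map_id, charFun_gaussianReal, hvar] at this
  simp only [ProbabilityMeasure.coe_mk, Measure.map_id, charFun_multivariateGaussian hS]
  have hnn : 0 ≤ t ⬝ᵥ S.mulVec t := by
    rw [← hcov]; exact integral_nonneg fun _ => sq_nonneg _
  convert this using 2 with n
  · rw [charFun_map_eq_charFun_map_inner (hsum n)]
    congr 3 with ω
    rw [hmean, inner_smul_right, inner_sum]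
    simp
  · simp [Real.coe_toNNReal _ hnn]

/-- The second moment matrix of a square integrable random vector represents the quadratic form
`t ↦ E⟨t, X⟩²`. -/
theorem integral_inner_sq_eq_dotProduct_mulVec {Ω : Type*} [MeasurableSpace Ω] {P : Measure Ω}
    {ι : Type*} [Fintype ι] {X : Ω → EuclideanSpace ℝ ι}
    (hX : MemLp X 2 P) (t : EuclideanSpace ℝ ι) :
    ∫ ω, (inner ℝ t (X ω)) ^ 2 ∂P =
      t ⬝ᵥ (Matrix.of fun i j => ∫ ω, X ω i * X ω j ∂P).mulVec t := by
  have hXi : ∀ i, MemLp (fun ω => X ω i) 2 P := fun i =>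
    (EuclideanSpace.proj i : EuclideanSpace ℝ ι →L[ℝ] ℝ).comp_memLp' hX
  have hij : ∀ i j, Integrable (fun ω => X ω i * X ω j) P := fun i j =>
    (hXi i).integrable_mul (hXi j)
  have hsq : ∀ ω, (inner ℝ t (X ω)) ^ 2 = ∑ i, ∑ j, t i * t j * (X ω i * X ω j) := by
    intro ω
    rw [sq, PiLp.inner_apply, Finset.sum_mul_sum]
    refine Finset.sum_congr rfl fun i _ => Finset.sum_congr rfl fun j _ => ?_
    simp
    ring
  simp_rw [hsq]
  rw [integral_finsetSum _ fun i _ => integrable_finsetSum _ fun j _ => (hij i j).const_mul _]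
  simp only [dotProduct, Matrix.mulVec, Matrix.of_apply, Finset.mul_sum]
  refine Finset.sum_congr rfl fun i _ => ?_
  rw [integral_finsetSum _ fun j _ => (hij i j).const_mul _]
  refine Finset.sum_congr rfl fun j _ => ?_
  rw [integral_const_mul]
  ring

theorem posSemidef_of_integral_mul {Ω : Type*} [MeasurableSpace Ω] {P : Measure Ω}
    {ι : Type*} [Fintype ι] {X : Ω → EuclideanSpace ℝ ι} (hX : MemLp X 2 P) :
    (Matrix.of fun i j => ∫ ω, X ω i * X ω j ∂P).PosSemidef := by
  refine Matrix.PosSemidef.of_dotProduct_mulVec_nonneg ?_ fun x => ?_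
  · ext i j
    simp [mul_comm]
  · have := integral_inner_sq_eq_dotProduct_mulVec hX (WithLp.toLp 2 x)
    simp only [star_trivial]
    exact this ▸ integral_nonneg fun _ => sq_nonneg _

/-! ### Boundedness in probability and linearization at a zero. -/

/-- Characteristic functions converging pointwise to a limit continuous at 0 force tightness. -/
theorem MeasureTheory.TendstoInDistribution.exists_measure_norm_gt_le {Ω E : Type*} [MeasurableSpace Ω]
    {P : Measure Ω} [IsProbabilityMeasure P]
    [NormedAddCommGroup E] [InnerProductSpace ℝ E] [FiniteDimensional ℝ E] [MeasurableSpace E]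
    [BorelSpace E] {Ω' : Type*} [MeasurableSpace Ω'] {P' : Measure Ω'} [IsProbabilityMeasure P']
    {X : ℕ → Ω → E} {Z : Ω' → E} (h : TendstoInDistribution X atTop Z (fun _ => P) P')
    {η : ENNReal} (hη : 0 < η) : ∃ K : ℝ, 0 ≤ K ∧ ∀ n, P {ω | K < ‖X n ω‖} ≤ η := by
  have := fun n => Measure.isProbabilityMeasure_map (h.forall_aemeasurable n)
  have := Measure.isProbabilityMeasure_map h.aemeasurable_limit
  have ht : IsTightMeasureSet (Set.range fun n => P.map (X n)) :=
    isTightMeasureSet_of_tendsto_charFun (f := charFun (P'.map Z)) (by fun_prop)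
      (ProbabilityMeasure.tendsto_iff_tendsto_charFun.1 h.tendsto)
  have h2 := tendsto_measure_norm_gt_of_isTightMeasureSet ht
  obtain ⟨K, hK, hK0⟩ :=
    (((tendsto_order.1 h2).2 η hη).and (eventually_ge_atTop 0)).exists
  refine ⟨K, hK0, fun n => ?_⟩
  have h3 : P.map (X n) {x | K < ‖x‖} ≤ η :=
    (le_iSup₂ (f := fun (μ : Measure E) (_ : μ ∈ Set.range fun n => P.map (X n)) =>
      μ {x | K < ‖x‖}) _ ⟨n, rfl⟩).trans hK.le
  rwa [Measure.map_apply_of_aemeasurable (h.forall_aemeasurable n)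
    (measurableSet_lt measurable_const measurable_norm)] at h3

/-- A quantitative inversion of a differentiable function at a zero: if `√n m(x)` is close to `-N`,
then `√n (x - x₀)` is close to `-L⁻¹ N`. -/
theorem norm_smul_sub_add_symm_le {E F : Type*} [NormedAddCommGroup E] [NormedSpace ℝ E]
    [NormedAddCommGroup F] [NormedSpace ℝ F] (L : E ≃L[ℝ] F) {C δ K r a : ℝ}
    (hC : ‖(L.symm : F →L[ℝ] E)‖ ≤ C) (hC0 : 0 ≤ C) (hδ0 : 0 ≤ δ) (hδ : C * δ ≤ 1 / 2)
    (ha : 0 ≤ a) {h : E} {y N : F} (hy : ‖y - L h‖ ≤ δ * ‖h‖) (hN : ‖N‖ ≤ K)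
    (hr : ‖a • y + N‖ ≤ r) :
    ‖a • h + L.symm N‖ ≤ 2 * C ^ 2 * δ * (K + r) + C * r := by
  have hLC : ∀ z, ‖L.symm z‖ ≤ C * ‖z‖ := fun z => (L.symm : F →L[ℝ] E).le_of_opNorm_le hC z
  have h1 : ‖h - L.symm y‖ ≤ C * δ * ‖h‖ := by
    have e : h - L.symm y = - L.symm (y - L h) := by simp
    rw [e, norm_neg]
    calc _ ≤ C * ‖y - L h‖ := hLC _
      _ ≤ C * (δ * ‖h‖) := by gcongr
      _ = _ := by ring
  have h2 : ‖h‖ ≤ 2 * C * ‖y‖ := by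
    have : ‖h‖ ≤ ‖h - L.symm y‖ + ‖L.symm y‖ := by simpa using norm_add_le (h - L.symm y) (L.symm y)
    -- Half of `‖h‖` is absorbed into the left-hand side.
    have h3 : C * δ * ‖h‖ ≤ 1 / 2 * ‖h‖ := by gcongr
    linarith [hLC y]
  have h3 : a * ‖y‖ ≤ K + r := by
    have e : a • y = (a • y + N) - N := by simp
    calc a * ‖y‖ = ‖a • y‖ := by rw [norm_smul, Real.norm_of_nonneg ha]
      _ ≤ ‖a • y + N‖ + ‖N‖ := by conv_lhs => rw [e]
                                  exact norm_sub_le _ _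
      _ ≤ K + r := by linarith
  have e : a • h + L.symm N = a • (h - L.symm y) + L.symm (a • y + N) := by
    simp only [smul_sub, map_add, map_smul]
    abel
  calc ‖a • h + L.symm N‖ ≤ ‖a • (h - L.symm y)‖ + ‖L.symm (a • y + N)‖ := e ▸ norm_add_le _ _
    _ ≤ a * (C * δ * (2 * C * ‖y‖)) + C * r := by
      rw [norm_smul, Real.norm_of_nonneg ha]
      have h4 : ‖L.symm (a • y + N)‖ ≤ C * r := (hLC _).trans (by gcongr)
      have h5 : C * δ * ‖h‖ ≤ C * δ * (2 * C * ‖y‖) := by gcongr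
      exact add_le_add (mul_le_mul_of_nonneg_left (h1.trans h5) ha) h4
    _ = 2 * C ^ 2 * δ * (a * ‖y‖) + C * r := by ring
    _ ≤ 2 * C ^ 2 * δ * (K + r) + C * r := by gcongr

/-- The linearization of a Z-estimator: if `a n • m (x n) + N n → 0` in probability, with `N` bounded
in probability and `x n → x₀` in probability, `m x₀ = 0`, and `m` has the invertible derivative `L`
at `x₀`, then `a n • (x n - x₀) + L⁻¹ (N n) → 0` in probability. -/
theorem tendsto_measure_smul_sub_add_symm {Ω E F : Type*} [MeasurableSpace Ω] {P : Measure Ω}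
    [NormedAddCommGroup E] [NormedSpace ℝ E] [NormedAddCommGroup F] [NormedSpace ℝ F]
    {s : Set E} {x₀ : E} {m : E → F} (L : E ≃L[ℝ] F)
    (hm : HasFDerivWithinAt m (L : E →L[ℝ] F) s x₀) (hm0 : m x₀ = 0)
    {a : ℕ → ℝ} (ha : ∀ n, 0 ≤ a n) {x : ℕ → Ω → E} (hxs : ∀ n ω, x n ω ∈ s)
    (hx : ∀ ε > 0, Tendsto (fun n => P {ω | ε < ‖x n ω - x₀‖}) atTop (𝓝 0)) {N : ℕ → Ω → F}
    (hN : ∀ η : ENNReal, 0 < η → ∃ K : ℝ, 0 ≤ K ∧ ∀ n, P {ω | K < ‖N n ω‖} ≤ η)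
    (hmN : ∀ ε > 0, Tendsto (fun n => P {ω | ε < ‖a n • m (x n ω) + N n ω‖}) atTop (𝓝 0))
    {ε : ℝ} (hε : 0 < ε) :
    Tendsto (fun n => P {ω | ε < ‖a n • (x n ω - x₀) + L.symm (N n ω)‖}) atTop (𝓝 0) := by
  obtain ⟨C, hC, hC1⟩ : ∃ C : ℝ, ‖(L.symm : F →L[ℝ] E)‖ ≤ C ∧ 0 < C :=
    ⟨‖(L.symm : F →L[ℝ] E)‖ + 1, by linarith, by positivity⟩
  refine ENNReal.tendsto_nhds_zero.2 fun η hη => ?_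
  have hη3 : 0 < η / 3 := ENNReal.div_pos hη.ne' (by simp)
  obtain ⟨K, hK0, hK⟩ := hN (η / 3) hη3
  -- `r` and `δ` make each of the two error terms of `norm_smul_sub_add_symm_le` at most `ε / 2`; `r
  -- ≤ 1` lets `δ` depend on `K + 1` only.
  let r := min 1 (ε / (2 * C))
  have hr : 0 < r := by positivity
  have hr1 : r ≤ 1 := min_le_left _ _
  have hCr : C * r ≤ ε / 2 := by
    calc C * r ≤ C * (ε / (2 * C)) := by gcongr; exact min_le_right _ _
      _ = ε / 2 := by field_simp
  let δ := min (1 / (2 * C)) (ε / (4 * C ^ 2 * (K + 1)))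
  have hδ : 0 < δ := by positivity
  have hCδ : C * δ ≤ 1 / 2 := by
    calc C * δ ≤ C * (1 / (2 * C)) := by gcongr; exact min_le_left _ _
      _ = 1 / 2 := by field_simp
  have hδK : 2 * C ^ 2 * δ * (K + r) ≤ ε / 2 := by
    calc 2 * C ^ 2 * δ * (K + r)
        ≤ 2 * C ^ 2 * (ε / (4 * C ^ 2 * (K + 1))) * (K + 1) := by
          gcongr; exact min_le_right _ _
      _ = ε / 2 := by field_simp; norm_num
  have hball := hm.isLittleO.def hδ
  rw [eventually_nhdsWithin_iff, Metric.eventually_nhds_iff] at hball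
  obtain ⟨ρ, hρ, hball⟩ := hball
  filter_upwards [ENNReal.tendsto_nhds_zero.1 (hx (ρ / 2) (by positivity)) _ hη3,
    ENNReal.tendsto_nhds_zero.1 (hmN r hr) _ hη3] with n h1 h2
  have hsub : {ω | ε < ‖a n • (x n ω - x₀) + L.symm (N n ω)‖} ⊆
      ({ω | ρ / 2 < ‖x n ω - x₀‖} ∪ {ω | r < ‖a n • m (x n ω) + N n ω‖}) ∪
        {ω | K < ‖N n ω‖} := by
    intro ω hω
    by_contra hcon
    simp only [Set.mem_union, Set.mem_ofPred_eq, not_or, not_lt] at hcon hω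
    obtain ⟨⟨hxω, hmω⟩, hNω⟩ := hcon
    have hy := hball (y := x n ω) (by rw [dist_eq_norm]; linarith) (hxs n ω)
    rw [hm0, sub_zero] at hy
    have := norm_smul_sub_add_symm_le L hC hC1.le hδ.le hCδ (ha n) hy hNω hmω
    linarith
  calc _ ≤ _ := measure_mono hsub
    _ ≤ η / 3 + η / 3 + η / 3 :=
      (measure_union_le _ _).trans (add_le_add ((measure_union_le _ _).trans (add_le_add h1 h2))
        (hK n))
    _ = η := ENNReal.add_thirds η

/-! ### Linear images and modification on small events. -/

/-- The central limit theorem for a linear image `T X` of centered square integrable vectors. -/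
theorem tendstoInDistribution_inv_sqrt_smul_sum_toEuclideanCLM {Ω : Type*} [MeasurableSpace Ω]
    {P : Measure Ω} [IsProbabilityMeasure P] {ι : Type*} [Fintype ι] [DecidableEq ι]
    {X : ℕ → Ω → EuclideanSpace ℝ ι} (T : Matrix ι ι ℝ)
    (hX : MemLp (X 0) 2 P) (h0 : ∫ ω, X 0 ω ∂P = 0)
    (hindep : iIndepFun X P) (hident : ∀ k, IdentDistrib (X k) (X 0) P P) :
    TendstoInDistribution (fun (n : ℕ) ω => (√(n : ℝ))⁻¹ • ∑ k ∈ Finset.range n,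
        Matrix.toEuclideanCLM (𝕜 := ℝ) T (X k ω)) atTop id (fun _ => P)
      (multivariateGaussian 0
        (T * (Matrix.of fun i j => ∫ ω, X 0 ω i * X 0 ω j ∂P) * T.transpose)) := by
  set J : Matrix ι ι ℝ := Matrix.of fun i j => ∫ ω, X 0 ω i * X 0 ω j ∂P with hJ
  have hV : (T * J * T.transpose).PosSemidef := by
    simpa using (posSemidef_of_integral_mul hX).mul_mul_conjTranspose_same T
  refine tendstoInDistribution_inv_sqrt_smul_sum
    (X := fun k ω => Matrix.toEuclideanCLM (𝕜 := ℝ) T (X k ω)) hV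
    ((Matrix.toEuclideanCLM (𝕜 := ℝ) T).comp_memLp' hX) ?_ (fun t => ?_)
    (hindep.comp (fun _ => Matrix.toEuclideanCLM (𝕜 := ℝ) T) fun _ => by fun_prop)
    (fun k => (hident k).comp (u := Matrix.toEuclideanCLM (𝕜 := ℝ) T) (by fun_prop))
  · rw [ContinuousLinearMap.integral_comp_comm _ (hX.integrable (by norm_num)), h0, map_zero]
  · have hadj : ∀ x : EuclideanSpace ℝ ι, inner ℝ t (Matrix.toEuclideanCLM (𝕜 := ℝ) T x) =
        inner ℝ (WithLp.toLp 2 (T.transpose.mulVec t)) x := by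
      intro x
      simp only [EuclideanSpace.inner_eq_star_dotProduct, Matrix.ofLp_toEuclideanCLM, star_trivial]
      rw [Matrix.mulVec_transpose, dotProduct_comm, Matrix.dotProduct_mulVec, dotProduct_comm]
    simp_rw [hadj]
    rw [integral_inner_sq_eq_dotProduct_mulVec hX, ← hJ]
    simp only [Matrix.mulVec_transpose, ← Matrix.mulVec_mulVec]
    rw [← Matrix.dotProduct_mulVec, Matrix.mulVec_mulVec]

/-- Random vectors that lie in `s`, and satisfy `q`, with probability tending to one can be modified,
on events of vanishing probability, to measurable ones that take values in `s` everywhere. -/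
theorem exists_measurable_mem_modification {Ω E : Type*} [MeasurableSpace Ω] {P : Measure Ω}
    [MeasurableSpace E] {s : Set E} {x₀ : E} (hx₀ : x₀ ∈ s) {x : ℕ → Ω → E}
    (hx : ∀ n, AEMeasurable (x n) P) {q : ℕ → Ω → Prop}
    (hq : Tendsto (fun n => P {ω | ¬ (x n ω ∈ s ∧ q n ω)}) atTop (𝓝 0)) :
    ∃ (y : ℕ → Ω → E) (A : ℕ → Set Ω), (∀ n, Measurable (y n)) ∧ (∀ n ω, y n ω ∈ s) ∧
      Tendsto (fun n => P (A n)) atTop (𝓝 0) ∧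
      ∀ n, ∀ ω ∉ A n, y n ω = x n ω ∧ q n ω := by
  classical
  -- The bad event need not be measurable; its measurable hull has the same measure and makes the
  -- piecewise definition measurable.
  let B : ℕ → Set Ω := fun n =>
    {ω | ¬ (x n ω ∈ s ∧ q n ω)} ∪ {ω | ¬ x n ω = (hx n).mk (x n) ω}
  have hB : ∀ n, P (toMeasurable P (B n)) = P {ω | ¬ (x n ω ∈ s ∧ q n ω)} := by
    intro n
    rw [measure_toMeasurable]
    have h0 : P {ω | ¬ x n ω = (hx n).mk (x n) ω} = 0 := (hx n).ae_eq_mk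
    exact le_antisymm ((measure_union_le _ _).trans (by rw [h0, add_zero]))
      (measure_mono Set.subset_union_left)
  have hout : ∀ n, ∀ ω ∉ toMeasurable P (B n),
      (x n ω ∈ s ∧ q n ω) ∧ x n ω = (hx n).mk (x n) ω := by
    intro n ω hω
    have : ω ∉ B n := fun h => hω (subset_toMeasurable P (B n) h)
    simpa only [B, Set.mem_union, Set.mem_ofPred_eq, not_or, not_not] using this
  refine ⟨fun n => (toMeasurable P (B n)).piecewise (fun _ => x₀) ((hx n).mk (x n)),
    fun n => toMeasurable P (B n),
    fun n => measurable_const.piecewise (measurableSet_toMeasurable _ _) (hx n).measurable_mk,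
    fun n ω => ?_, by simpa only [hB] using hq, fun n ω hω => ?_⟩
  · by_cases hω : ω ∈ toMeasurable P (B n)
    · simpa [hω] using hx₀
    · obtain ⟨⟨h1, -⟩, h2⟩ := hout n ω hω
      simpa [hω, ← h2] using h1
  · obtain ⟨⟨-, h1⟩, h2⟩ := hout n ω hω
    exact ⟨by simp [hω, h2], h1⟩

theorem tendsto_measure_of_subset_union {Ω : Type*} [MeasurableSpace Ω] {P : Measure Ω}
    {B C A : ℕ → Set Ω} (hB : Tendsto (fun n => P (B n)) atTop (𝓝 0))
    (hA : Tendsto (fun n => P (A n)) atTop (𝓝 0)) (h : ∀ n, ∀ᵐ ω ∂P, ω ∈ C n → ω ∈ B n ∪ A n) :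
    Tendsto (fun n => P (C n)) atTop (𝓝 0) := by
  have hsum := hB.add hA
  rw [add_zero] at hsum
  exact tendsto_of_tendsto_of_tendsto_of_le_of_le tendsto_const_nhds hsum (fun _ => zero_le)
    fun n => (measure_mono_ae (h n)).trans (measure_union_le _ _)

/-! ### Asymptotic normality. -/

theorem theorem3 {Ω : Type*} [MeasurableSpace Ω] (P : Measure Ω) [IsProbabilityMeasure P]
    {p d : ℕ} (Ξ : Set (EuclideanSpace ℝ (Fin p))) (hΞ : UniqueDiffOn ℝ Ξ)
    (f : EuclideanSpace ℝ (Fin p) → EuclideanSpace ℝ (Fin d) → ℝ)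
    (hf : IsParametricDensity Ξ f)
    -- i.i.d. random measures
    (μ : ℕ → Ω → Measure (EuclideanSpace ℝ (Fin d)))
    (hμ_meas : ∀ k, Measurable (μ k))
    (hμ_indep : iIndepFun μ P)
    (hμ_ident : ∀ k, IdentDistrib (μ k) (μ 0) P P)
    -- the loss and the score are well defined
    (hlik : ∀ k, ∀ᵐ ω ∂P, ∀ c ∈ Ξ,
      IntegrableOn (f c) (μ k ω).support (μ k ω) ∧ 0 < genLik f (μ k ω) c)
    (hdiff : ∀ k, ∀ᵐ ω ∂P, DifferentiableOn ℝ (genLoss f (μ k ω)) Ξ)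
    (hint : ∀ c ∈ Ξ, Integrable (fun ω => genScore Ξ f (μ 0 ω) c) P)
    -- the target parameter
    (ξ : EuclideanSpace ℝ (Fin p)) (hξ : ξ ∈ Ξ)
    (hξ_zero : meanScore P Ξ f μ ξ = 0)
    (hξ_sq : MemLp (fun ω => genScore Ξ f (μ 0 ω) ξ) 2 P)
    -- the derivative `M` of `c ↦ E[Z_c]` at `ξ` exists and is invertible
    (M : Matrix (Fin p) (Fin p) ℝ)
    (hM : HasFDerivWithinAt (meanScore P Ξ f μ) (Matrix.toEuclideanCLM (𝕜 := ℝ) M) Ξ ξ)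
    (hM_inv : M.det ≠ 0)
    -- a consistent Z-estimator
    (ξt : ℕ → Ω → EuclideanSpace ℝ (Fin p))
    (hξt : IsZEstimator P Ξ f μ ξt)
    (hcons : ∀ ε > 0, Tendsto (fun n => P {ω | ε < ‖ξt n ω - ξ‖}) atTop (𝓝 0))
    (hν : AsymptoticallyContinuousAt P Ξ (empiricalProcess P Ξ f μ) ξ) :
    (M⁻¹ * scoreMatrix P Ξ f μ ξ * M⁻¹.transpose).PosSemidef ∧
    TendstoInDistribution (fun (n : ℕ) (ω : Ω) => √(n : ℝ) • (ξt n ω - ξ)) atTop id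
      (fun _ => P)
      (multivariateGaussian 0 (M⁻¹ * scoreMatrix P Ξ f μ ξ * M⁻¹.transpose)) := by
  refine ⟨by simpa [scoreMatrix] using
    (posSemidef_of_integral_mul hξ_sq).mul_mul_conjTranspose_same M⁻¹, ?_⟩
  obtain ⟨G, hG, hscoreG⟩ := exists_measurable_eq_genScore hΞ hf hξ
  have hGae : ∀ k, (fun ω => genScore Ξ f (μ k ω) ξ) =ᵐ[P] fun ω => G (μ k ω) := fun k => by
    filter_upwards [hdiff k] with ω hω using hscoreG _ hω
  -- the central limit theorem for the scores at the target parameter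
  let T := Matrix.toEuclideanCLM (𝕜 := ℝ) (-M⁻¹)
  let D : ℕ → Ω → EuclideanSpace ℝ (Fin p) := fun n ω =>
    (√(n : ℝ))⁻¹ • ∑ k ∈ Finset.range n, T (G (μ k ω))
  have hJ : (Matrix.of fun i j => ∫ ω, G (μ 0 ω) i * G (μ 0 ω) j ∂P) =
      scoreMatrix P Ξ f μ ξ := by
    ext i j
    refine integral_congr_ae ?_
    filter_upwards [hGae 0] with ω hω
    rw [hω]
  have hclt : TendstoInDistribution D atTop id (fun _ => P)
      (multivariateGaussian 0 (M⁻¹ * scoreMatrix P Ξ f μ ξ * M⁻¹.transpose)) := by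
    have := tendstoInDistribution_inv_sqrt_smul_sum_toEuclideanCLM (P := P)
      (X := fun k ω => G (μ k ω)) (-M⁻¹) ((memLp_congr_ae (hGae 0)).1 hξ_sq)
      ((integral_congr_ae (hGae 0)).symm.trans hξ_zero)
      (hμ_indep.comp (fun _ => G) fun _ => hG) (fun k => (hμ_ident k).comp hG)
    rw [hJ] at this
    simpa only [Matrix.transpose_neg, neg_mul, mul_neg, neg_neg] using this
  -- the derivative of the population score as an isomorphism
  have hdet : IsUnit M.det := hM_inv.isUnit
  let L : EuclideanSpace ℝ (Fin p) ≃L[ℝ] EuclideanSpace ℝ (Fin p) :=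
    ContinuousLinearEquiv.equivOfInverse (Matrix.toEuclideanCLM (𝕜 := ℝ) M)
      (Matrix.toEuclideanCLM (𝕜 := ℝ) M⁻¹)
      (fun x => by
        rw [← mul_apply_eq_comp, ← map_mul, Matrix.nonsing_inv_mul M hdet]; simp)
      (fun x => by
        rw [← mul_apply_eq_comp, ← map_mul, Matrix.mul_nonsing_inv M hdet]; simp)
  have hLT : ∀ x, L (T x) = -x := fun x => by
    have : T x = -L.symm x := by simp [T, L]
    rw [this, map_neg, L.apply_symm_apply]
  -- Defining `N` through `D` lets its tightness follow from `hclt` by continuous mapping.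
  let N : ℕ → Ω → EuclideanSpace ℝ (Fin p) := fun n ω => -L (D n ω)
  have hNsum : ∀ n ω, N n ω = (√(n : ℝ))⁻¹ • ∑ k ∈ Finset.range n, G (μ k ω) := fun n ω => by
    simp only [N, D, map_smul, map_sum, hLT, Finset.sum_neg_distrib, smul_neg, neg_neg]
  -- True also at `n = 0`, since `0⁻¹ = 0`.
  have hsqrt : ∀ n : ℕ, √(n : ℝ) * (n : ℝ)⁻¹ = (√(n : ℝ))⁻¹ := fun n => by
    rw [← div_eq_mul_inv, Real.sqrt_div_self', one_div]
  -- a measurable version of the estimator with values in the parameter set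
  obtain ⟨y, A, hy_meas, hyΞ, hA, hyA⟩ :=
    exists_measurable_mem_modification hξ hξt.aemeasurable hξt.solves
  have hy : ∀ ε > 0, Tendsto (fun n => P {ω | ε < ‖y n ω - ξ‖}) atTop (𝓝 0) := fun ε hε =>
    tendsto_measure_of_subset_union (hcons ε hε) hA fun n => ae_of_all _ fun ω hω => by
      by_cases hωA : ω ∈ A n
      · exact Or.inr hωA
      · exact Or.inl (by simpa [← (hyA n ω hωA).1] using hω)
  have hyN : ∀ ε > 0, Tendsto
      (fun n : ℕ => P {ω | ε < ‖√(n : ℝ) • meanScore P Ξ f μ (y n ω) + N n ω‖}) atTop (𝓝 0) :=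
    fun ε hε => tendsto_measure_of_subset_union (hν y hy_meas hyΞ hy ε hε) hA fun n => by
      filter_upwards [ae_all_iff.2 hGae] with ω hGω hω
      by_cases hωA : ω ∈ A n
      · exact Or.inr hωA
      · left
        obtain ⟨h1, h2⟩ := hyA n ω hωA
        rw [← h1] at h2
        have e : empiricalProcess P Ξ f μ n (y n ω) ω - empiricalProcess P Ξ f μ n ξ ω =
            -(√(n : ℝ) • meanScore P Ξ f μ (y n ω) + N n ω) := by
          simp only [empiricalProcess, h2, hξ_zero, hGω, hNsum, smul_zero, zero_sub, sub_zero,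
            smul_smul, hsqrt, smul_neg]
          abel
        rw [Set.mem_ofPred_eq, e, norm_neg]
        exact hω
  have hlin : ∀ ε > 0, Tendsto
      (fun n : ℕ => P {ω | ε < ‖√(n : ℝ) • (y n ω - ξ) + L.symm (N n ω)‖}) atTop (𝓝 0) :=
    fun ε hε => tendsto_measure_smul_sub_add_symm L hM hξ_zero (fun n => Real.sqrt_nonneg _)
      hyΞ hy (fun η hη => (hclt.continuous_comp
        (g := fun x => -L x) (by fun_prop)).exists_measure_norm_gt_le hη) hyN hε
  -- Slutsky: it suffices that the difference from `D` tends to 0 in measure.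
  refine tendstoInDistribution_of_tendstoInMeasure_sub _ _ hclt ?_
    fun n => ((hξt.aemeasurable n).sub_const ξ).const_smul (√(n : ℝ))
  rw [tendstoInMeasure_iff_norm]
  intro ε hε
  -- Convergence in measure uses `ε ≤ ‖·‖`, while `hlin` has a strict inequality; hence `ε / 2`.
  refine tendsto_measure_of_subset_union (hlin (ε / 2) (by positivity)) hA fun n =>
    ae_of_all _ fun ω hω => ?_
  by_cases hωA : ω ∈ A n
  · exact Or.inr hωA
  · left
    have e : L.symm (N n ω) = -D n ω := by simp [N]
    simp only [Set.mem_ofPred_eq, Pi.sub_apply, Pi.zero_apply, sub_zero] at hω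
    rw [Set.mem_ofPred_eq, e, (hyA n ω hωA).1, ← sub_eq_add_neg]
    linarith
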